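/- For an integer $N>1$ let $X_{[N]}=\{1,\dots,N\}^{\mathbb N}$ with the product of the discrete topologies, and let $\sigma\colon X_{[N]}\to X_{[N]}$, $\sigma((x_n)_{n\in\mathbb N})=(x_{n+1})_{n\in\mathbb N}$, be the shift map (the one-sided full $N$-shift). Let $\Gamma_{[N]}$ be its continuous full group, that is, the group under composition of all homeomorphisms $\tau$ of $X_{[N]}$ for which there exist continuous functions $k,l\colon X_{[N]}\to\mathbb Z_{\ge 0}$ (with $\mathbb Z_{\ge 0}$ discrete) such that $$\sigma^{k(x)}(\tau(x))=\sigma^{l(x)}(x)\qquad\text{for all } x\in X_{[N]}.$$ Let $N,M>1$ be integers. Then $\Gamma_{[N]}$ and $\Gamma_{[M]}$ are isomorphic as abstract groups if and only if $N=M$. -/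

import Mathlib

/-- The continuous full group of a topological dynamical system `(X, σ)`: the subgroup of all
homeomorphisms `τ` of `X` for which there are continuous orbit cocycles, that is, continuous
functions `k, l : X → ℕ` (with `ℕ` discrete) such that `σ ^ k(x) (τ x) = σ ^ l(x) x` for all `x`.
In particular `τ x` lies in the `σ`-orbit `⋃ k, ⋃ l, σ ^ (-k) (σ ^ l x)` of `x`. -/
def continuousFullGroup {X : Type*} [TopologicalSpace X] (σ : X → X) : Subgroup (X ≃ₜ X) where
  carrier := {τ | ∃ k l : X → ℕ, Continuous k ∧ Continuous l ∧
    ∀ x, σ^[k x] (τ x) = σ^[l x] x}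
  one_mem' := ⟨fun _ => 0, fun _ => 0, continuous_const, continuous_const, fun _ => rfl⟩
  mul_mem' := by
    rintro τ₁ τ₂ ⟨k₁, l₁, hk₁, hl₁, h₁⟩ ⟨k₂, l₂, hk₂, hl₂, h₂⟩
    refine ⟨fun x => k₂ x + k₁ (τ₂ x), fun x => l₁ (τ₂ x) + l₂ x,
      hk₂.add (hk₁.comp τ₂.continuous), (hl₁.comp τ₂.continuous).add hl₂, fun x => ?_⟩
    rw [Homeomorph.mul_apply, Function.iterate_add_apply, h₁, ← Function.iterate_add_apply,
      Nat.add_comm, Function.iterate_add_apply, h₂, ← Function.iterate_add_apply]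
  inv_mem' := by
    rintro τ ⟨k, l, hk, hl, h⟩
    refine ⟨fun x => l (τ⁻¹ x), fun x => k (τ⁻¹ x), hl.comp (τ⁻¹).continuous,
      hk.comp (τ⁻¹).continuous, fun x => ?_⟩
    have := h (τ⁻¹ x)
    rw [Homeomorph.inv_apply, Homeomorph.apply_symm_apply] at this
    exact this.symm

/-- The shift transformation `(x₀, x₁, x₂, …) ↦ (x₁, x₂, x₃, …)` of the one-sided full `N`-shift.
The space `ℕ → Fin N` carries the product of the discrete topologies. -/
def oneSidedShift (N : ℕ) : (ℕ → Fin N) → (ℕ → Fin N) :=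
  SymbolicDynamics.FullShift.shift (1 : ℕ)

/-- The shift map drops the first letter. -/
theorem oneSidedShift_apply (N : ℕ) (x : ℕ → Fin N) (n : ℕ) :
    oneSidedShift N x n = x (n + 1) := by
  simp [oneSidedShift, Nat.add_comm]

/-- The continuous full group of the one-sided full `N`-shift. -/
abbrev fullShiftGroup (N : ℕ) : Subgroup ((ℕ → Fin N) ≃ₜ (ℕ → Fin N)) :=
  continuousFullGroup (oneSidedShift N)

/-!
The invariant that separates the groups is the number of conjugacy classes of elements of a suitable
prime order, as in Higman's classification of the groups `V_{n,r}`.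

Elements of the full group replace long enough prefixes by other prefixes
(`FullShift.exists_forall_app`), and conversely two complete prefix codes with the same index set
define an element (`FullShift.IsCode.exists_mem_fullShiftGroup`). If a set is a disjoint union of
`k` cylinders, then `k` is determined modulo `N - 1`, because splitting a cylinder replaces it by
`N` smaller ones, and this residue is preserved by the full group (`FullShift.IsCode.card_modEq`,
`FullShift.IsCode.card_modEq_of_image`).

An element of finite order permutes the cylinders of some complete prefix code
(`FullShift.exists_isCode_perm`). If the order is a prime `p`, there are `a ≥ 1` cycles of length
`p` and `b` fixed cylinders, with `p a + b ≡ 1` modulo `N - 1`. Two elements with the same `a` and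
`b` are conjugate. Splitting all cylinders of a cycle increases `a` by `N - 1`, and splitting
a fixed cylinder, if there is one, increases `b` by `N - 1`. For `p ≡ 1` modulo `N - 1` the residue
of `a` is determined by that of `b`, so the conjugacy class is determined by the residue of `b`
together with the truth value of `b = 0`. The latter says that there are no fixed points and the
former is the residue of the set of fixed points, so both depend only on the conjugacy class.
There are `N - 1` classes with `b ≠ 0`, and `b = 0` adds one more, so that there are exactly `N`
classes of elements of order `p` (`FullShift.card_conjClasses_orderOf_eq`). A prime congruent to
`1` modulo `(N - 1) (M - 1)` serves for `N` and `M` at the same time.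
-/

namespace FullShift

open Topology

variable {N : ℕ}

/-! ### Words and codes -/

/-- The sequence `u z` obtained by writing the finite word `u` in front of the sequence `z`. -/
def app : List (Fin N) → (ℕ → Fin N) → (ℕ → Fin N)
  | [], z => z
  | a :: u, z => fun n => Nat.casesOn n a (app u z)

/-- The word formed by the first `n` letters of a sequence. -/
def pre : ℕ → (ℕ → Fin N) → List (Fin N)
  | 0, _ => []
  | n + 1, x => x 0 :: pre n (oneSidedShift N x)

@[simp] lemma app_nil (z : ℕ → Fin N) : app [] z = z := rfl

@[simp] lemma app_cons_zero (a : Fin N) (u : List (Fin N)) (z : ℕ → Fin N) :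
    app (a :: u) z 0 = a := rfl

@[simp] lemma app_cons_succ (a : Fin N) (u : List (Fin N)) (z : ℕ → Fin N) (n : ℕ) :
    app (a :: u) z (n + 1) = app u z n := rfl

@[simp] lemma shift_app_cons (a : Fin N) (u : List (Fin N)) (z : ℕ → Fin N) :
    oneSidedShift N (app (a :: u) z) = app u z := by
  funext n
  rw [oneSidedShift_apply, app_cons_succ]

lemma app_zero_shift (x : ℕ → Fin N) : app [x 0] (oneSidedShift N x) = x := by
  funext n
  cases n with
  | zero => rfl
  | succ n => rw [app_cons_succ, app_nil, oneSidedShift_apply]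

lemma app_append (u v : List (Fin N)) (z : ℕ → Fin N) : app (u ++ v) z = app u (app v z) := by
  induction u with
  | nil => rfl
  | cons a u ih => funext n; cases n <;> simp [ih]

@[simp] lemma length_pre (n : ℕ) (x : ℕ → Fin N) : (pre n x).length = n := by
  induction n generalizing x with
  | zero => rfl
  | succ n ih => simp [pre, ih]

@[simp] lemma app_pre_shift (n : ℕ) (x : ℕ → Fin N) :
    app (pre n x) ((oneSidedShift N)^[n] x) = x := by
  induction n generalizing x with
  | zero => rfl
  | succ n ih =>
    rw [pre, Function.iterate_succ_apply, ← List.singleton_append, app_append, ih, app_zero_shift]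

@[simp] lemma pre_length_app (u : List (Fin N)) (z : ℕ → Fin N) : pre u.length (app u z) = u := by
  induction u with
  | nil => rfl
  | cons a u ih => simp [pre, ih]

@[simp] lemma shift_iterate_app (u : List (Fin N)) (z : ℕ → Fin N) :
    (oneSidedShift N)^[u.length] (app u z) = z := by
  induction u with
  | nil => rfl
  | cons a u ih => simp [ih]

lemma pre_eq_iff {n : ℕ} {x y : ℕ → Fin N} : pre n x = pre n y ↔ ∀ i < n, x i = y i := by
  induction n generalizing x y with
  | zero => simp [pre]
  | succ n ih => simp [pre, ih, Nat.forall_lt_succ_left', oneSidedShift_apply, -Order.lt_add_one_iff]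

lemma pre_eq_of_le {m n : ℕ} (h : m ≤ n) {x y : ℕ → Fin N} (hxy : pre n x = pre n y) :
    pre m x = pre m y :=
  pre_eq_iff.2 fun i hi => pre_eq_iff.1 hxy i (hi.trans_le h)

lemma app_right_injective (u : List (Fin N)) : Function.Injective (app u) := fun x y h => by
  rw [← shift_iterate_app u x, h, shift_iterate_app]

lemma app_left_injective {u v : List (Fin N)} (h : u.length = v.length) {x y : ℕ → Fin N}
    (hxy : app u x = app v y) : u = v := by
  rw [← pre_length_app u x, hxy, h, pre_length_app]

lemma pre_eq_iff_exists {u : List (Fin N)} {x : ℕ → Fin N} :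
    pre u.length x = u ↔ ∃ z, x = app u z :=
  ⟨fun h => ⟨(oneSidedShift N)^[u.length] x, by
    conv_rhs => rw [← h]
    simp⟩, by rintro ⟨z, rfl⟩; simp⟩

/-- If every sequence beginning with `v` begins with `u`, then `u` is a prefix of `v`: a longer `u`
would force the letter that follows `v`. -/
lemma prefix_of_forall_exists [Nontrivial (Fin N)] {u v : List (Fin N)}
    (h : ∀ z, ∃ y, app v z = app u y) : u <+: v := by
  induction u generalizing v with
  | nil => exact List.nil_prefix
  | cons a u ih =>
    cases v with
    | nil =>
      obtain ⟨b, hb⟩ := exists_ne a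
      obtain ⟨y, hy⟩ := h fun _ => b
      exact absurd (congrFun hy 0) hb
    | cons b v =>
      obtain ⟨y, hy⟩ := h fun _ => a
      have hab : b = a := congrFun hy 0
      subst hab
      rw [List.cons_prefix_cons]
      refine ⟨rfl, ih fun z => ?_⟩
      obtain ⟨y, hy⟩ := h z
      exact ⟨y, by simpa using congrArg (oneSidedShift N) hy⟩

lemma app_length_add (u : List (Fin N)) (z : ℕ → Fin N) (i : ℕ) :
    app u z (u.length + i) = z i := by
  induction u with
  | nil => simp
  | cons a u ih => rw [List.length_cons, Nat.add_right_comm, app_cons_succ, ih]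

lemma one_lt_card_letters [Nontrivial (Fin N)] : 1 < N :=
  Fin.nontrivial_iff_two_le.1 inferInstance

lemma card_letters_modEq_one [Nontrivial (Fin N)] : N ≡ 1 [MOD (N - 1)] :=
  ((Nat.modEq_iff_dvd' one_lt_card_letters.le).2 dvd_rfl).symm

lemma sum_pow_modEq_card [Nontrivial (Fin N)] {I : Type*} [Fintype I] (f : I → ℕ) :
    ∑ i, N ^ f i ≡ Fintype.card I [MOD (N - 1)] := by
  rw [Fintype.card_eq_sum_ones]
  exact Nat.ModEq.sum fun i _ => by simpa using! card_letters_modEq_one.pow (f i)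

/-- Sequences that are constant from position `n` on correspond to words of length `n`. -/
def eventuallyConstEquiv (c : Fin N) (n : ℕ) :
    {x : ℕ → Fin N // ∀ i, n ≤ i → x i = c} ≃ (Fin n → Fin N) where
  toFun x i := x.1 i
  invFun w := ⟨fun i => if h : i < n then w ⟨i, h⟩ else c, fun i hi => dif_neg hi.not_gt⟩
  left_inv x := Subtype.ext <| funext fun i => by
    by_cases h : i < n
    · simp [h]
    · simp [h, x.2 i (not_lt.1 h)]
  right_inv w := by simp

lemma finite_eventually_const (c : Fin N) (n : ℕ) :
    Finite {x : ℕ → Fin N // ∀ i, n ≤ i → x i = c} :=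
  Finite.of_equiv _ (eventuallyConstEquiv c n).symm

lemma card_eventually_const_univ (c : Fin N) (n : ℕ) :
    Nat.card {x : ℕ → Fin N // ∀ i, n ≤ i → x i = c} = N ^ n := by
  rw [Nat.card_congr (eventuallyConstEquiv c n)]
  simp

/-- A prefix code for the set `A`: a family of words `u j` such that each point of `A` is `u j z`
for exactly one index `j` and one sequence `z`, and such that all these sequences lie in `A`. In
other words, `A` is the disjoint union of the cylinders of the words `u j`. -/
structure IsCode {J : Type*} (u : J → List (Fin N)) (A : Set (ℕ → Fin N)) : Prop where
  mem : ∀ j z, app (u j) z ∈ A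
  exists_eq : ∀ x ∈ A, ∃ j z, x = app (u j) z
  inj : ∀ i j y z, app (u i) y = app (u j) z → i = j

namespace IsCode

variable {J K L : Type*} {A : Set (ℕ → Fin N)}

lemma inj_right {u : J → List (Fin N)} (h : IsCode u A) {i j : J} {y z : ℕ → Fin N}
    (hyz : app (u i) y = app (u j) z) : y = z := by
  obtain rfl := h.inj _ _ _ _ hyz
  exact app_right_injective _ hyz

lemma reindex {u : J → List (Fin N)} (h : IsCode u A) (e : K ≃ J) : IsCode (u ∘ e) A where
  mem _ _ := h.mem _ _
  exists_eq x hx := by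
    obtain ⟨j, z, rfl⟩ := h.exists_eq x hx
    exact ⟨e.symm j, z, by simp⟩
  inj i j y z hyz := e.injective (h.inj _ _ _ _ hyz)

lemma nil : IsCode (fun _ : Unit => ([] : List (Fin N))) Set.univ where
  mem _ _ := trivial
  exists_eq x _ := ⟨(), x, rfl⟩
  inj _ _ _ _ _ := rfl

/-- Splitting each of the words indexed by `L` into its `N` one-letter extensions. -/
lemma split {u : K ⊕ L → List (Fin N)} (h : IsCode u A) :
    IsCode (Sum.elim (fun k => u (.inl k)) (fun l : L × Fin N => u (.inr l.1) ++ [l.2])) A where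
  mem j z := by
    rcases j with k | l
    · exact h.mem _ _
    · simpa [app_append] using h.mem (.inr l.1) _
  exists_eq x hx := by
    obtain ⟨k | l, z, rfl⟩ := h.exists_eq x hx
    · exact ⟨.inl k, z, rfl⟩
    · exact ⟨.inr (l, z 0), oneSidedShift N z, by simp [app_append, app_zero_shift]⟩
  inj i j y z hyz := by
    rcases i with k | ⟨l, a⟩ <;> rcases j with k' | ⟨l', a'⟩ <;>
      simp only [Sum.elim_inl, Sum.elim_inr, app_append] at hyz
    · simpa using h.inj _ _ _ _ hyz
    · simpa using h.inj _ _ _ _ hyz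
    · simpa using h.inj _ _ _ _ hyz
    · have h1 : l = l' := by simpa using h.inj _ _ _ _ hyz
      have h2 : a = a' := congrFun (h.inj_right hyz) 0
      rw [h1, h2]

/-- Every code can be refined so that all its words have length at least `m`, without changing the
number of words modulo `N - 1`. -/
lemma exists_refine [Nontrivial (Fin N)] [Fintype J] {u : J → List (Fin N)} (h : IsCode u A)
    (m : ℕ) :
    ∃ (K : Type) (_ : Fintype K) (v : K → List (Fin N)), IsCode v A ∧ (∀ k, m ≤ (v k).length) ∧
      Fintype.card K ≡ Fintype.card J [MOD (N - 1)] := by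
  induction m with
  | zero =>
    exact ⟨Fin (Fintype.card J), inferInstance, _, h.reindex (Fintype.equivFin J).symm, by simp,
      by simpa using Nat.ModEq.refl _⟩
  | succ m ih =>
    obtain ⟨K, _, v, hv, hm, hK⟩ := ih
    refine ⟨Empty ⊕ K × Fin N, inferInstance, _,
      (hv.reindex (Equiv.emptySum Empty K)).split, ?_, ?_⟩
    · rintro (k | k)
      · exact k.elim
      · simpa using hm k.1
    · rw [Fintype.card_sum, Fintype.card_prod, Fintype.card_fin, Fintype.card_empty, zero_add]
      exact ((card_letters_modEq_one.mul_left _).trans (by rw [mul_one])).trans hK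

/-- The number of points of `A` that are constantly equal to `c` from position `n` on. -/
lemma card_eventually_const [Fintype J] {u : J → List (Fin N)} (h : IsCode u A) (c : Fin N)
    {n : ℕ} (hn : ∀ j, (u j).length ≤ n) :
    Nat.card {x : ℕ → Fin N // x ∈ A ∧ ∀ i, n ≤ i → x i = c} = ∑ j, N ^ (n - (u j).length) := by
  simp_rw [← card_eventually_const_univ c]
  have := finite_eventually_const c
  rw [← Nat.card_sigma]
  have key : ∀ j z, (∀ i, n ≤ i → app (u j) z i = c) ↔ ∀ i, n - (u j).length ≤ i → z i = c := by
    refine fun j z => ⟨fun hz i hi => ?_, fun hz i hi => ?_⟩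
    · rw [← app_length_add (u j) z i]
      exact hz _ (by omega)
    · obtain ⟨k, rfl⟩ := Nat.exists_eq_add_of_le ((hn j).trans hi)
      rw [app_length_add]
      exact hz k (by omega)
  symm
  refine Nat.card_eq_of_bijective
    (fun s => ⟨app (u s.1) s.2.1, h.mem _ _, (key _ _).2 s.2.2⟩) ⟨?_, ?_⟩
  · rintro ⟨i, y, hy⟩ ⟨j, z, hz⟩ hyz
    have hyz := congrArg Subtype.val hyz
    obtain rfl := h.inj _ _ _ _ hyz
    obtain rfl := h.inj_right hyz
    rfl
  · rintro ⟨x, hx, hc⟩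
    obtain ⟨j, z, rfl⟩ := h.exists_eq x hx
    exact ⟨⟨j, z, (key _ _).1 hc⟩, rfl⟩

/-- The number of words of a prefix code for `A` is determined by `A` modulo `N - 1`:
as `N ≡ 1`, it is congruent to the number of points of `A` that are constantly equal to `c` from
a position `n` on that is at least the length of each word. -/
lemma card_modEq [Nontrivial (Fin N)] [Fintype J] [Fintype K] {u : J → List (Fin N)}
    {v : K → List (Fin N)} (hu : IsCode u A) (hv : IsCode v A) :
    Fintype.card J ≡ Fintype.card K [MOD (N - 1)] := by
  obtain ⟨c⟩ : Nonempty (Fin N) := inferInstance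
  let n := ∑ j, (u j).length + ∑ k, (v k).length
  have h1 : ∀ j, (u j).length ≤ n := fun j =>
    (Finset.single_le_sum (f := fun j => (u j).length) (fun _ _ => Nat.zero_le _)
      (Finset.mem_univ j)).trans (Nat.le_add_right _ _)
  have h2 : ∀ k, (v k).length ≤ n := fun k =>
    (Finset.single_le_sum (f := fun k => (v k).length) (fun _ _ => Nat.zero_le _)
      (Finset.mem_univ k)).trans (Nat.le_add_left _ _)
  have heq := (hu.card_eventually_const c h1).symm.trans (hv.card_eventually_const c h2)
  exact (sum_pow_modEq_card _).symm.trans ((congrArg (· % (N - 1)) heq).trans (sum_pow_modEq_card _))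

end IsCode

/-- There is a complete prefix code with `1 + t (N - 1)` words, for every `t`. -/
lemma exists_isCode_univ [Nontrivial (Fin N)] (t : ℕ) {J : Type} [Fintype J]
    (hJ : Fintype.card J = 1 + t * (N - 1)) : ∃ u : J → List (Fin N), IsCode u Set.univ := by
  have hN : 1 < N := one_lt_card_letters
  induction t generalizing J with
  | zero =>
    exact ⟨_, IsCode.nil.reindex (Fintype.equivOfCardEq (by simpa using hJ))⟩
  | succ t ih =>
    obtain ⟨u, hu⟩ := ih (J := Fin (t * (N - 1)) ⊕ Unit) (by simp [add_comm])
    refine ⟨_, hu.split.reindex (Fintype.equivOfCardEq ?_)⟩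
    simp only [hJ, Fintype.card_sum, Fintype.card_prod, Fintype.card_fin, Fintype.card_unit]
    obtain ⟨k, rfl⟩ := Nat.exists_eq_add_of_lt hN
    simp only [Nat.add_sub_cancel]
    ring

/-! ### Elements of the full group as prefix replacements -/

lemma isOpen_setOf_pre (n : ℕ) (u : List (Fin N)) : IsOpen {x : ℕ → Fin N | pre n x = u} := by
  rcases Set.eq_empty_or_nonempty {x : ℕ → Fin N | pre n x = u} with h | ⟨x, hx⟩
  · rw [h]
    exact isOpen_empty
  · rw [show {y : ℕ → Fin N | pre n y = u} = PiNat.cylinder x n by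
      ext y
      rw [Set.mem_ofPred_eq, PiNat.mem_cylinder_iff, ← pre_eq_iff, hx]]
    exact PiNat.isOpen_cylinder _ _ _

lemma isLocallyConstant_pre (n : ℕ) : IsLocallyConstant (pre n : (ℕ → Fin N) → List (Fin N)) :=
  IsLocallyConstant.iff_isOpen_fiber.2 fun u => isOpen_setOf_pre n u

lemma exists_pre_eq_subset {U : Set (ℕ → Fin N)} {x : ℕ → Fin N} (hU : U ∈ 𝓝 x) :
    ∃ n, ∀ y, pre n y = pre n x → y ∈ U := by
  obtain ⟨V, ⟨z, n, rfl⟩, hx, hV⟩ :=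
    (PiNat.isTopologicalBasis_cylinders fun _ : ℕ => Fin N).mem_nhds_iff.1 hU
  refine ⟨n, fun y hy => hV ?_⟩
  rw [PiNat.mem_cylinder_iff] at hx ⊢
  exact fun i hi => (pre_eq_iff.1 hy i hi).trans (hx i hi)

lemma continuous_shift : Continuous (oneSidedShift N) :=
  continuous_pi fun n => by
    simp_rw [oneSidedShift_apply]
    exact continuous_apply _

lemma continuous_app (u : List (Fin N)) : Continuous (app u) := by
  induction u with
  | nil => exact continuous_id
  | cons a u ih =>
    refine continuous_pi fun n => ?_
    cases n with
    | zero => exact continuous_const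
    | succ n => exact (continuous_apply n).comp ih

/-- An element of the full group acts on all sufficiently long prefixes by prefix replacement: the
length of prefix that is needed at a point is bounded, by compactness. -/
lemma exists_forall_app {g : (ℕ → Fin N) ≃ₜ (ℕ → Fin N)} (hg : g ∈ fullShiftGroup N) :
    ∃ m, ∀ u : List (Fin N), m ≤ u.length → ∃ v, ∀ z, g (app u z) = app v z := by
  obtain ⟨k, l, hk, hl, h⟩ := hg
  have step : ∀ {u w : List (Fin N)}, (∃ v, ∀ z, g (app u z) = app v z) →
      ∃ v, ∀ z, g (app (u ++ w) z) = app v z := by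
    rintro u w ⟨v, hv⟩
    exact ⟨v ++ w, fun z => by rw [app_append, app_append, hv]⟩
  have mono : ∀ {m n : ℕ} {x : ℕ → Fin N}, m ≤ n →
      (∃ v, ∀ z, g (app (pre m x) z) = app v z) → ∃ v, ∀ z, g (app (pre n x) z) = app v z := by
    intro m n x hmn hm
    have hpre : pre m x ++ (pre n x).drop m = pre n x := by
      have h1 : pre m x = (pre n x).take m := by
        refine app_left_injective (x := (oneSidedShift N)^[m] x)
          (y := app ((pre n x).drop m) ((oneSidedShift N)^[n] x)) (by simp [hmn]) ?_
        rw [← app_append, List.take_append_drop, app_pre_shift, app_pre_shift]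
      rw [h1, List.take_append_drop]
    rw [← hpre]
    exact step hm
  -- near `x` the cocycles `k`, `l` and the first `k x` letters of `g y` are constant, and the
  -- remaining letters of `g y` are those of `y` from position `l x` on
  have cover : ∀ x, ∃ n, ∃ v, ∀ z, g (app (pre n x) z) = app v z := by
    intro x
    have hU : {y | k y = k x ∧ l y = l x ∧ pre (k x) (g y) = pre (k x) (g x)} ∈ 𝓝 x := by
      have h1 := (IsLocallyConstant.iff_eventually_eq _).1
        ((IsLocallyConstant.iff_continuous k).2 hk) x
      have h2 := (IsLocallyConstant.iff_eventually_eq _).1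
        ((IsLocallyConstant.iff_continuous l).2 hl) x
      have h3 := (IsLocallyConstant.iff_eventually_eq _).1
        ((isLocallyConstant_pre (k x)).comp_continuous g.continuous) x
      filter_upwards [h1, h2, h3] with y a b c using ⟨a, b, c⟩
    obtain ⟨n, hn⟩ := exists_pre_eq_subset hU
    refine ⟨n + l x, pre (k x) (g x) ++ (pre (n + l x) x).drop (l x), fun z => ?_⟩
    set u := pre (n + l x) x with hu
    have hlen : u.length = n + l x := length_pre _ _
    obtain ⟨a, b, c⟩ := hn (app u z) (pre_eq_of_le (n := n + l x) (Nat.le_add_right _ _)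
      (by rw [← hlen, pre_length_app, hlen]))
    have hs := h (app u z)
    rw [a, b] at hs
    rw [← app_pre_shift (k x) (g (app u z)), c, hs, app_append]
    congr 1
    have h4 : (u.take (l x)).length = l x := by simp [hlen]
    conv_lhs => rw [← List.take_append_drop (l x) u, app_append]
    exact (congrArg (fun i => (oneSidedShift N)^[i] _) h4.symm).trans (shift_iterate_app _ _)
  obtain ⟨m, hm⟩ := isCompact_univ.elim_directed_cover
    (fun n => {x | ∃ v, ∀ z, g (app (pre n x) z) = app v z})
    (fun n => (isLocallyConstant_pre n) {u | ∃ v, ∀ z, g (app u z) = app v z})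
    (fun x _ => Set.mem_iUnion.2 (cover x))
    (directed_of_isDirected_le fun _ _ hmn _ hx => mono hmn hx)
  refine ⟨m, fun u hu => ?_⟩
  by_cases hne : Nonempty (ℕ → Fin N)
  · obtain ⟨z⟩ := hne
    have := mono hu (hm (Set.mem_univ (app u z)))
    rwa [pre_length_app] at this
  · exact ⟨u, fun z => (hne ⟨z⟩).elim⟩

/-- Two complete prefix codes with the same index set define an element of the full group, which
replaces the prefix `u j` by `v j` for each `j`. -/
lemma IsCode.exists_mem_fullShiftGroup {J : Type*} {u v : J → List (Fin N)}
    (hu : IsCode u Set.univ) (hv : IsCode v Set.univ) :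
    ∃ g : fullShiftGroup N, ∀ j z, g.1 (app (u j) z) = app (v j) z := by
  have aux : ∀ {u : J → List (Fin N)}, IsCode u Set.univ → ∃ idx : (ℕ → Fin N) → J,
      IsLocallyConstant idx ∧ ∀ j z, idx (app (u j) z) = j := by
    intro u hu
    choose idx rest h using fun x => hu.exists_eq x trivial
    have hidx : ∀ j z, idx (app (u j) z) = j := fun j z => hu.inj _ _ _ _ (h (app (u j) z)).symm
    refine ⟨idx, (IsLocallyConstant.iff_eventually_eq _).2 fun x => ?_, hidx⟩
    have := (isOpen_setOf_pre (u (idx x)).length (u (idx x))).mem_nhds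
      (pre_eq_iff_exists.2 ⟨_, h x⟩)
    filter_upwards [this] with y hy
    obtain ⟨z, rfl⟩ := pre_eq_iff_exists.1 hy
    exact hidx _ _
  -- the map that replaces prefixes according to `u j ↦ v j` is continuous
  have replace : ∀ {u v : J → List (Fin N)}, IsCode u Set.univ → ∃ f : (ℕ → Fin N) → (ℕ → Fin N),
      Continuous f ∧ ∀ j z, f (app (u j) z) = app (v j) z := by
    intro u v hu
    obtain ⟨idx, hloc, hidx⟩ := aux hu
    refine ⟨fun x => app (v (idx x)) ((oneSidedShift N)^[(u (idx x)).length] x),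
      continuous_iff_continuousAt.2 fun x => ?_, fun j z => by simp [hidx]⟩
    have hc : Continuous fun y => app (v (idx x)) ((oneSidedShift N)^[(u (idx x)).length] y) :=
      (continuous_app _).comp (continuous_shift.iterate _)
    refine hc.continuousAt.congr ?_
    filter_upwards [(IsLocallyConstant.iff_eventually_eq _).1 hloc x] with y hy
    rw [hy]
  obtain ⟨f, hf, hfu⟩ := replace (v := v) hu
  obtain ⟨f', hf', hfv⟩ := replace (v := u) hv
  obtain ⟨idx, hloc, hidx⟩ := aux hu
  refine ⟨⟨⟨⟨f, f', fun x => ?_, fun x => ?_⟩, hf, hf'⟩, fun x => (v (idx x)).length,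
    fun x => (u (idx x)).length, (hloc.comp fun j => (v j).length).continuous,
    (hloc.comp fun j => (u j).length).continuous, fun x => ?_⟩, hfu⟩
  · obtain ⟨j, z, rfl⟩ := hu.exists_eq x trivial
    rw [hfu, hfv]
  · obtain ⟨j, z, rfl⟩ := hv.exists_eq x trivial
    rw [hfv, hfu]
  · obtain ⟨j, z, rfl⟩ := hu.exists_eq x trivial
    change (oneSidedShift N)^[_] (f _) = _
    beta_reduce
    rw [hfu, hidx, shift_iterate_app, shift_iterate_app]

/-- The full group preserves the number of words of a prefix code modulo `N - 1`. -/
lemma IsCode.card_modEq_of_image [Nontrivial (Fin N)] {J K : Type*} [Fintype J] [Fintype K]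
    {A B : Set (ℕ → Fin N)} {u : J → List (Fin N)} {v : K → List (Fin N)} (hu : IsCode u A)
    (hv : IsCode v B) {g : (ℕ → Fin N) ≃ₜ (ℕ → Fin N)} (hg : g ∈ fullShiftGroup N)
    (hAB : ∀ x, x ∈ A ↔ g x ∈ B) : Fintype.card J ≡ Fintype.card K [MOD (N - 1)] := by
  obtain ⟨m, hm⟩ := exists_forall_app hg
  obtain ⟨I, _, u', hu', hlen, hI⟩ := hu.exists_refine m
  choose w hw using fun i => hm (u' i) (hlen i)
  have hwB : IsCode w B :=
    { mem := fun i z => by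
        rw [← hw, ← hAB]
        exact hu'.mem _ _
      exists_eq := fun x hx => by
        obtain ⟨i, z, h⟩ := hu'.exists_eq (g.symm x) ((hAB _).2 (by simpa using hx))
        exact ⟨i, z, by rw [← hw, ← h, g.apply_symm_apply]⟩
      inj := fun i j y z h => by
        rw [← hw, ← hw] at h
        exact hu'.inj _ _ _ _ (g.injective h) }
  exact hI.symm.trans (hwB.card_modEq hv)

/-! ### Elements of finite order permute a prefix code -/

/-- The partition of the space by the first `m` letters of `g x` is a partition into cylinders, if
`m` is large. -/
lemma exists_pre_apply_eq_iff {g : (ℕ → Fin N) ≃ₜ (ℕ → Fin N)} {m : ℕ}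
    (hm : ∀ u : List (Fin N), m ≤ u.length → ∃ v, ∀ z, g.symm (app u z) = app v z)
    (x : ℕ → Fin N) : ∃ k, ∀ y, pre m (g y) = pre m (g x) ↔ pre k y = pre k x := by
  obtain ⟨v, hv⟩ := hm (pre m (g x)) (by simp)
  have key : ∀ y, pre m (g y) = pre m (g x) ↔ pre v.length y = v := by
    intro y
    rw [pre_eq_iff_exists]
    have := pre_eq_iff_exists (u := pre m (g x)) (x := g y)
    rw [length_pre] at this
    rw [this]
    refine exists_congr fun z => ?_
    rw [← hv, Homeomorph.eq_symm_apply]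
  refine ⟨v.length, fun y => ?_⟩
  rw [key y, (key x).1 rfl]

/-- An element `τ` of finite order permutes the cylinders of a complete prefix code, by prefix
replacement. The cylinders are the atoms of the common refinement of the images under the powers of
`τ` of the partition into cylinders of a fixed large length: an intersection of cylinders is
a cylinder or empty. -/
lemma exists_isCode_perm [Nontrivial (Fin N)] {p : ℕ} (hp : 0 < p) {τ : fullShiftGroup N}
    (hτ : τ ^ p = 1) : ∃ (J : Type) (_ : Fintype J) (u : J → List (Fin N)) (π : Equiv.Perm J),
      IsCode u Set.univ ∧ ∀ j z, τ.1 (app (u j) z) = app (u (π j)) z := by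
  choose M hM using fun g : fullShiftGroup N => exists_forall_app g.2
  let m := M τ + ∑ i ∈ Finset.range p, M (τ ^ i)⁻¹
  have hmτ : M τ ≤ m := Nat.le_add_right _ _
  have hmi : ∀ i < p, M (τ ^ i)⁻¹ ≤ m := fun i hi =>
    (Finset.single_le_sum (f := fun i => M (τ ^ i)⁻¹) (fun _ _ => Nat.zero_le _)
      (Finset.mem_range.2 hi)).trans (Nat.le_add_left _ _)
  let s : Setoid (ℕ → Fin N) :=
    { r := fun x y => ∀ i, pre m ((τ ^ i).1 y) = pre m ((τ ^ i).1 x)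
      iseqv := ⟨fun _ _ => rfl, fun h i => (h i).symm, fun h h' i => (h' i).trans (h i)⟩ }
  have hs : ∀ {x y}, (∀ i < p, pre m ((τ ^ i).1 y) = pre m ((τ ^ i).1 x)) → s x y := by
    intro x y h i
    rw [pow_eq_pow_mod i hτ]
    exact h _ (Nat.mod_lt _ hp)
  -- the class of `x` is an intersection of cylinders around `x`, hence one of them
  have hcyl : ∀ x, ∃ K, m ≤ K ∧ ∀ y, s x y ↔ pre K y = pre K x := by
    intro x
    have : ∀ i, ∃ k, i < p → ∀ y, pre m ((τ ^ i).1 y) = pre m ((τ ^ i).1 x) ↔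
        pre k y = pre k x := by
      intro i
      by_cases hi : i < p
      · obtain ⟨k, hk⟩ := exists_pre_apply_eq_iff (g := (τ ^ i).1) (m := m)
          (fun u hu => hM (τ ^ i)⁻¹ u ((hmi i hi).trans hu)) x
        exact ⟨k, fun _ => hk⟩
      · exact ⟨0, fun h => absurd h hi⟩
    choose k hk using this
    refine ⟨max m ((Finset.range p).sup k), le_max_left _ _, fun y => ⟨fun h => ?_, fun h => ?_⟩⟩
    · refine pre_eq_iff.2 fun i hi => ?_
      rcases lt_max_iff.1 hi with hi | hi
      · exact pre_eq_iff.1 (by simpa using h 0) i hi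
      · obtain ⟨a, ha, hia⟩ := Finset.lt_sup_iff.1 hi
        exact pre_eq_iff.1 ((hk a (Finset.mem_range.1 ha) y).1 (h a)) i hia
    · exact hs fun i hi => (hk i hi y).2 (pre_eq_of_le
        ((Finset.le_sup (Finset.mem_range.2 hi)).trans (le_max_right _ _)) h)
  choose K hmK hK using hcyl
  let u : Quotient s → List (Fin N) := fun j => pre (K j.out) j.out
  have hu : ∀ j y, (⟦y⟧ : Quotient s) = j ↔ ∃ z, y = app (u j) z := by
    intro j y
    rw [← pre_eq_iff_exists, length_pre, ← hK, eq_comm]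
    conv_lhs => rw [← Quotient.out_eq j]
    exact Quotient.eq
  have : Finite (Quotient s) := by
    have hfac : ∀ x y, s x y → (fun i : Fin p => fun k : Fin m => (τ ^ i.1).1 x k) =
        fun i : Fin p => fun k : Fin m => (τ ^ i.1).1 y k :=
      fun x y h => funext fun i => funext fun k => (pre_eq_iff.1 (h i.1) k k.2).symm
    refine Finite.of_injective (Quotient.lift _ hfac) fun a b => ?_
    refine Quotient.inductionOn₂ a b fun x y h => Quotient.sound (hs fun i hi => ?_)
    exact pre_eq_iff.2 fun k hk => (congrFun (congrFun h ⟨i, hi⟩) ⟨k, hk⟩).symm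
  let π : Equiv.Perm (Quotient s) := Quotient.congr τ.1.toEquiv fun x y => by
    refine ⟨fun h i => h (i + 1), fun h => hs fun i hi => ?_⟩
    cases i with
    | zero =>
      have h' : pre m ((τ ^ (p - 1)).1 (τ.1 y)) = pre m ((τ ^ (p - 1)).1 (τ.1 x)) := h (p - 1)
      have hp1 : ∀ z, (τ ^ (p - 1)).1 (τ.1 z) = (τ ^ 0).1 z := fun z => by
        rw [pow_zero, ← hτ, ← Nat.sub_add_cancel (Nat.succ_le_of_lt hp), pow_succ]
        rfl
      rwa [hp1, hp1] at h'
    | succ i => exact h i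
  have hπ : ∀ x, π ⟦x⟧ = ⟦τ.1 x⟧ := fun x => rfl
  refine ⟨Quotient s, Fintype.ofFinite _, u, π,
    ⟨fun _ _ => trivial, fun x _ => ⟨⟦x⟧, (hu _ x).1 rfl⟩, fun i j y z h => ?_⟩, fun j z => ?_⟩
  · rw [← (hu i _).2 ⟨y, rfl⟩, h, (hu j _).2 ⟨z, rfl⟩]
  · -- `τ` replaces the prefix `u j` by some `v`, and it maps the cylinder of `u j` onto that of
    -- `u (π j)`, so the cylinders of `v` and `u (π j)` coincide
    obtain ⟨v, hv⟩ := hM τ (u j) (hmτ.trans ((hmK _).trans (length_pre _ _).ge))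
    have h1 : u (π j) <+: v := prefix_of_forall_exists fun z => by
      rw [← hv, ← hu, ← hπ, (hu j _).2 ⟨z, rfl⟩]
    have h2 : v <+: u (π j) := prefix_of_forall_exists fun z => by
      obtain ⟨z', hz'⟩ := (hu j (τ.1.symm (app (u (π j)) z))).1 <| π.injective <| by
        rw [hπ, τ.1.apply_symm_apply]
        exact (hu _ _).2 ⟨z, rfl⟩
      exact ⟨z', by rw [← hv, ← hz', τ.1.apply_symm_apply]⟩
    rw [hv, h1.eq_of_length_le h2.length_le]

variable {p : ℕ}

/-! ### Normal form of the elements of prime order -/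

/-- The permutation of `(ZMod p × A) ⊕ B` that has the sets `ZMod p × {a}` as cycles of length `p`
and fixes the points of `B`. -/
def rotation (p : ℕ) (A B : Type*) : Equiv.Perm ((ZMod p × A) ⊕ B) :=
  ((Equiv.addRight 1).prodCongr (Equiv.refl A)).sumCongr (Equiv.refl B)

@[simp] lemma rotation_inl {A B : Type*} (i : ZMod p) (a : A) :
    rotation p A B (.inl (i, a)) = .inl (i + 1, a) := rfl

@[simp] lemma rotation_inr {A B : Type*} (b : B) : rotation p A B (.inr b) = .inr b := rfl

lemma rotation_pow_inl {A B : Type*} (n : ℕ) (i : ZMod p) (a : A) :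
    (rotation p A B ^ n) (.inl (i, a)) = .inl (i + n, a) := by
  induction n with
  | zero => simp
  | succ n ih => rw [pow_succ', Equiv.Perm.mul_apply, ih, rotation_inl, Nat.cast_succ, add_assoc]

lemma rotation_pow (A B : Type*) : rotation p A B ^ p = 1 := by
  ext x
  rcases x with ⟨i, a⟩ | b
  · simp [rotation_pow_inl]
  · have : ∀ n : ℕ, (rotation p A B ^ n) (.inr b) = .inr b := fun n => by
      induction n with
      | zero => rfl
      | succ n ih => rw [pow_succ', Equiv.Perm.mul_apply, ih, rotation_inr]
    rw [this, Equiv.Perm.one_apply]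

lemma cycleType_eq_replicate [hp : Fact p.Prime] {J : Type*} [Fintype J] [DecidableEq J]
    {π : Equiv.Perm J} (h : π ^ p = 1) :
    π.cycleType = Multiset.replicate (Multiset.card π.cycleType) p := by
  refine Multiset.eq_replicate.2 ⟨rfl, fun n hn => ?_⟩
  exact ((Nat.dvd_prime hp.out).1 ((Equiv.Perm.dvd_of_mem_cycleType hn).trans
    (orderOf_dvd_of_pow_eq_one h))).resolve_left
      (Equiv.Perm.one_lt_of_mem_cycleType hn).ne'

/-- A permutation of order dividing the prime `p` is equivalent to a rotation. -/
lemma exists_equiv_rotation [Fact p.Prime] {J : Type*} [Fintype J] {π : Equiv.Perm J}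
    (h : π ^ p = 1) : ∃ a b : ℕ, ∃ e : (ZMod p × Fin a) ⊕ Fin b ≃ J,
      ∀ x, e (rotation p _ _ x) = π (e x) := by
  classical
  set a := Multiset.card π.cycleType with ha
  have hsupp : π.support.card = a * p := by
    rw [← Equiv.Perm.sum_cycleType, cycleType_eq_replicate h, Multiset.sum_replicate, smul_eq_mul]
  have hle : a * p ≤ Fintype.card J := hsupp ▸ Finset.card_le_univ _
  obtain ⟨b, hb⟩ := Nat.exists_eq_add_of_le hle
  let e₀ : (ZMod p × Fin a) ⊕ Fin b ≃ J :=
    Fintype.equivOfCardEq (by simp [ZMod.card, hb, mul_comm])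
  let ρ : Equiv.Perm J := e₀.permCongr (rotation p _ _)
  have hρ : ρ ^ p = 1 := by
    have : ρ ^ p = e₀.permCongr (rotation p _ _ ^ p) := (map_pow e₀.permCongrHom _ p).symm
    rw [this, rotation_pow]
    exact map_one e₀.permCongrHom
  have hρs : ρ.support.card = a * p := by
    have : ρ.support = (Finset.univ : Finset (ZMod p × Fin a)).map
        (Function.Embedding.inl.trans e₀.toEmbedding) := by
      ext x
      obtain ⟨⟨i, c⟩ | c, rfl⟩ := e₀.surjective x <;>
        simp [ρ, Equiv.Perm.mem_support, Equiv.permCongr_apply]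
    rw [this, Finset.card_map]
    simp [ZMod.card, mul_comm]
  have hconj : IsConj ρ π := by
    rw [Equiv.Perm.isConj_iff_cycleType_eq, cycleType_eq_replicate h, cycleType_eq_replicate hρ]
    congr 1
    have h1 := ρ.sum_cycleType
    rw [cycleType_eq_replicate hρ, Multiset.sum_replicate, smul_eq_mul, hρs] at h1
    exact Nat.eq_of_mul_eq_mul_right (NeZero.pos p) h1
  obtain ⟨c, hc⟩ := isConj_iff.1 hconj
  refine ⟨a, b, e₀.trans c, fun x => ?_⟩
  rw [← hc]
  simp [ρ, Equiv.permCongr_apply]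

/-- The element `τ` of the full group acts, by prefix replacement, as the permutation
`rotation p A B` of the cylinders of a complete prefix code. -/
def HasRotationForm (p : ℕ) (τ : fullShiftGroup N) (A B : Type) : Prop :=
  ∃ u : (ZMod p × A) ⊕ B → List (Fin N), IsCode u Set.univ ∧
    ∀ j z, τ.1 (app (u j) z) = app (u (rotation p A B j)) z

lemma pow_apply_app {J : Type*} {τ : fullShiftGroup N} {u : J → List (Fin N)} {π : Equiv.Perm J}
    (h : ∀ j z, τ.1 (app (u j) z) = app (u (π j)) z) (n : ℕ) (j : J) (z : ℕ → Fin N) :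
    (τ ^ n).1 (app (u j) z) = app (u ((π ^ n) j)) z := by
  induction n with
  | zero => rfl
  | succ n ih =>
    rw [pow_succ', pow_succ', Equiv.Perm.mul_apply, ← h, ← ih]
    rfl

lemma ext_of_isCode {J : Type*} {u : J → List (Fin N)} (hu : IsCode u Set.univ)
    {g h : fullShiftGroup N} (hgh : ∀ j z, g.1 (app (u j) z) = h.1 (app (u j) z)) : g = h := by
  refine Subtype.ext (Homeomorph.ext fun x => ?_)
  obtain ⟨j, z, rfl⟩ := hu.exists_eq x trivial
  exact hgh j z

lemma exists_hasRotationForm [Nontrivial (Fin N)] [hp : Fact p.Prime] {τ : fullShiftGroup N}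
    (hτ : orderOf τ = p) : ∃ a b : ℕ, HasRotationForm p τ (Fin (a + 1)) (Fin b) := by
  obtain ⟨J, _, u, π, hu, h⟩ := exists_isCode_perm hp.out.pos (hτ ▸ pow_orderOf_eq_one τ)
  have hπ : π ^ p = 1 := by
    obtain ⟨c⟩ : Nonempty (Fin N) := inferInstance
    ext j
    refine hu.inj _ _ (fun _ => c) (fun _ => c) ?_
    rw [← pow_apply_app h, ← hτ, pow_orderOf_eq_one]
    rfl
  obtain ⟨a, b, e, he⟩ := exists_equiv_rotation hπ
  have key : HasRotationForm p τ (Fin a) (Fin b) :=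
    ⟨u ∘ e, hu.reindex e, fun j z => by rw [Function.comp_apply, h, ← he]; rfl⟩
  cases a with
  | zero =>
    obtain ⟨u, hu, h⟩ := key
    refine absurd (orderOf_eq_one_iff.2 (ext_of_isCode hu (h := 1) fun j z => ?_))
      (hτ ▸ hp.out.ne_one)
    rcases j with ⟨_, i⟩ | b
    · exact i.elim0
    · exact h _ z
  | succ a => exact ⟨a, b, key⟩

namespace HasRotationForm

variable {τ τ' : fullShiftGroup N} {A A' B B' L : Type}

lemma orderOf_eq [Nontrivial (Fin N)] [hp : Fact p.Prime] [Nonempty A]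
    (h : HasRotationForm p τ A B) : orderOf τ = p := by
  obtain ⟨u, hu, h⟩ := h
  obtain ⟨c⟩ : Nonempty (Fin N) := inferInstance
  obtain ⟨a⟩ := ‹Nonempty A›
  refine orderOf_eq_prime (ext_of_isCode hu fun j z => ?_) fun h1 => ?_
  · rw [pow_apply_app h, rotation_pow]
    rfl
  · have := h (.inl (0, a)) fun _ => c
    rw [h1] at this
    have := hu.inj _ _ _ _ this
    simp at this

lemma congr (h : HasRotationForm p τ A B) (e : A' ≃ A) (f : B' ≃ B) :
    HasRotationForm p τ A' B' := by
  obtain ⟨u, hu, h⟩ := h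
  refine ⟨_, hu.reindex (((Equiv.refl (ZMod p)).prodCongr e).sumCongr f), ?_⟩
  rintro (⟨i, a⟩ | b) z
  · exact h _ z
  · exact h _ z

/-- Splitting fixed cylinders. -/
lemma split_right (h : HasRotationForm p τ A (B ⊕ L)) :
    HasRotationForm p τ A (B ⊕ L × Fin N) := by
  obtain ⟨u, hu, h⟩ := h
  refine ⟨_, (hu.reindex (Equiv.sumAssoc _ _ _)).split.reindex (Equiv.sumAssoc _ _ _).symm, ?_⟩
  rintro (⟨i, a⟩ | b | ⟨l, c⟩) z
  · exact h (.inl (i, a)) z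
  · exact h (.inr (.inl b)) z
  · simpa [app_append] using h (.inr (.inr l)) (app [c] z)

/-- Splitting all the cylinders of some cycles. -/
lemma split_left (h : HasRotationForm p τ (A ⊕ L) B) :
    HasRotationForm p τ (A ⊕ L × Fin N) B := by
  obtain ⟨u, hu, h⟩ := h
  let e : ∀ M : Type, ((ZMod p × A) ⊕ B) ⊕ (ZMod p × M) ≃ (ZMod p × (A ⊕ M)) ⊕ B := fun M =>
    { toFun := Sum.elim (Sum.map (Prod.map id .inl) id) fun x => .inl (x.1, .inr x.2)
      invFun := Sum.elim (fun x => Sum.elim (fun a => .inl (.inl (x.1, a))) (fun l => .inr (x.1, l))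
        x.2) (fun b => .inl (.inr b))
      left_inv := by rintro ((⟨i, a⟩ | b) | ⟨i, l⟩) <;> rfl
      right_inv := by rintro (⟨i, a | l⟩ | b) <;> rfl }
  refine ⟨_, (hu.reindex (e L)).split.reindex ((e (L × Fin N)).symm.trans
    ((Equiv.refl _).sumCongr (Equiv.prodAssoc _ _ _).symm)), ?_⟩
  rintro (⟨i, a | ⟨l, c⟩⟩ | b) z
  · exact h (.inl (i, .inl a)) z
  · simpa [e, app_append] using h (.inl (i, .inr l)) (app [c] z)
  · exact h (.inr b) z

lemma add_right [Nontrivial (Fin N)] {b : ℕ} (h : HasRotationForm p τ A (Fin (b + 1))) (t : ℕ) :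
    HasRotationForm p τ A (Fin (b + 1 + t * (N - 1))) := by
  have hN : 1 < N := one_lt_card_letters
  induction t with
  | zero => simpa using h
  | succ t ih =>
    refine (split_right (L := Unit) (B := Fin (b + t * (N - 1)))
      (ih.congr (Equiv.refl _) (Fintype.equivOfCardEq ?_))).congr (Equiv.refl _)
        (Fintype.equivOfCardEq ?_)
    · simp; ring
    · obtain ⟨k, rfl⟩ := Nat.exists_eq_add_of_lt hN
      simp; ring

lemma add_left [Nontrivial (Fin N)] {a : ℕ} (h : HasRotationForm p τ (Fin (a + 1)) B) (t : ℕ) :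
    HasRotationForm p τ (Fin (a + 1 + t * (N - 1))) B := by
  have hN : 1 < N := one_lt_card_letters
  induction t with
  | zero => simpa using h
  | succ t ih =>
    refine (split_left (L := Unit) (A := Fin (a + t * (N - 1)))
      (ih.congr (Fintype.equivOfCardEq ?_) (Equiv.refl _))).congr
        (Fintype.equivOfCardEq ?_) (Equiv.refl _)
    · simp; ring
    · obtain ⟨k, rfl⟩ := Nat.exists_eq_add_of_lt hN
      simp; ring

lemma isConj (h : HasRotationForm p τ A B) (h' : HasRotationForm p τ' A B) : IsConj τ τ' := by
  obtain ⟨u, hu, h⟩ := h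
  obtain ⟨u', hu', h'⟩ := h'
  obtain ⟨g, hg⟩ := hu.exists_mem_fullShiftGroup hu'
  refine isConj_iff.2 ⟨g, mul_inv_eq_iff_eq_mul.2 (ext_of_isCode hu fun j z => ?_)⟩
  change g.1 (τ.1 _) = τ'.1 (g.1 _)
  rw [h, hg, hg, h']

lemma card_modEq [Nontrivial (Fin N)] [NeZero p] {a b : ℕ}
    (h : HasRotationForm p τ (Fin a) (Fin b)) : p * a + b ≡ 1 [MOD (N - 1)] := by
  obtain ⟨u, hu, -⟩ := h
  simpa [ZMod.card] using hu.card_modEq (IsCode.nil (N := N))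

lemma exists_isCode_fixed [Nontrivial (Fin N)] [Fact p.Prime] (h : HasRotationForm p τ A B) :
    ∃ u : B → List (Fin N), IsCode u {x | τ.1 x = x} := by
  obtain ⟨u, hu, h⟩ := h
  refine ⟨u ∘ Sum.inr, fun b z => h _ z, fun x hx => ?_, fun i j y z hyz => ?_⟩
  · obtain ⟨⟨i, a⟩ | b, z, rfl⟩ := hu.exists_eq x trivial
    · have := hu.inj _ _ _ _ ((h _ z).symm.trans hx)
      simp at this
    · exact ⟨b, z, rfl⟩
  · exact Sum.inr_injective (hu.inj _ _ _ _ hyz)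

end HasRotationForm

/-! ### Counting conjugacy classes -/

/-- The invariant of an element of rotation form with `b` fixed cylinders: the residue of `b` modulo
`q`, with `b = 0` kept apart from the nonzero multiples of `q`. -/
def fixedKey (q b : ℕ) : Option (ZMod q) := if b = 0 then none else some b

lemma fixedKey_eq_iff {q b b' : ℕ} :
    fixedKey q b = fixedKey q b' ↔ (b = 0 ↔ b' = 0) ∧ b ≡ b' [MOD q] := by
  unfold fixedKey
  split_ifs with h h' h'
  · simp [h, h', Nat.ModEq.refl]
  · simp [h, h']
  · simp [h, h']
  · simp [h, h', ZMod.natCast_eq_natCast_iff]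

lemma exists_add_mul_eq {q m n : ℕ} (h : m ≡ n [MOD q]) : ∃ s t, m + s * q = n + t * q := by
  rcases le_total m n with hmn | hmn
  · obtain ⟨c, hc⟩ := (Nat.modEq_iff_dvd' hmn).1 h
    exact ⟨c, 0, by rw [mul_comm c, ← hc]; omega⟩
  · obtain ⟨c, hc⟩ := (Nat.modEq_iff_dvd' hmn).1 h.symm
    exact ⟨0, c, by rw [mul_comm c, ← hc]; omega⟩

/-- For `p ≡ 1 [MOD N - 1]`, the elements of order `p` are classified up to conjugacy by the number
of fixed cylinders modulo `N - 1` and by whether there are any. -/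
lemma HasRotationForm.isConj_iff_fixedKey_eq [Nontrivial (Fin N)] [Fact p.Prime]
    (hp : p ≡ 1 [MOD (N - 1)]) {τ τ' : fullShiftGroup N} {a a' b b' : ℕ}
    (h : HasRotationForm p τ (Fin (a + 1)) (Fin b))
    (h' : HasRotationForm p τ' (Fin (a' + 1)) (Fin b')) :
    IsConj τ τ' ↔ fixedKey (N - 1) b = fixedKey (N - 1) b' := by
  rw [fixedKey_eq_iff]
  constructor
  · intro hc
    obtain ⟨g, rfl⟩ := isConj_iff.1 hc
    obtain ⟨u, hu⟩ := h.exists_isCode_fixed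
    obtain ⟨u', hu'⟩ := h'.exists_isCode_fixed
    have hg : ∀ x, x ∈ {x | τ.1 x = x} ↔ g.1 x ∈ {x | (g * τ * g⁻¹).1 x = x} := fun x => by
      change _ ↔ g.1 (τ.1 (g.1.symm (g.1 x))) = g.1 x
      rw [g.1.symm_apply_apply, g.1.injective.eq_iff]
      rfl
    refine ⟨?_, by simpa using hu.card_modEq_of_image hu' g.2 hg⟩
    obtain ⟨c⟩ : Nonempty (Fin N) := inferInstance
    constructor
    · rintro rfl
      by_contra hb
      have := hu'.mem ⟨0, Nat.pos_of_ne_zero hb⟩ fun _ => c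
      rw [← g.1.apply_symm_apply (app _ _), ← hg] at this
      obtain ⟨j, -⟩ := hu.exists_eq _ this
      exact j.elim0
    · rintro rfl
      by_contra hb
      have := hu.mem ⟨0, Nat.pos_of_ne_zero hb⟩ fun _ => c
      rw [hg] at this
      obtain ⟨j, -⟩ := hu'.exists_eq _ this
      exact j.elim0
  · rintro ⟨h0, hb⟩
    have ha : a + 1 ≡ a' + 1 [MOD (N - 1)] := by
      have h1 : ∀ c, p * c ≡ c [MOD (N - 1)] := fun c => by simpa using! hp.mul_right c
      have h2 := ((h1 _).add_right b).symm.trans (h.card_modEq.trans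
        (h'.card_modEq.symm.trans ((h1 _).add_right b')))
      exact hb.add_right_cancel h2
    obtain ⟨s, t, hst⟩ := exists_add_mul_eq ha
    have H := h.add_left s
    have H' := h'.add_left t
    rw [hst] at H
    rcases b with _ | b
    · obtain rfl := h0.1 rfl
      exact H.isConj H'
    · rcases b' with _ | b'
      · simp at h0
      · obtain ⟨s', t', hst'⟩ := exists_add_mul_eq hb
        have K := H.add_right s'
        rw [hst'] at K
        exact K.isConj (H'.add_right t')

lemma exists_hasRotationForm_of_card [Nontrivial (Fin N)] [NeZero p] {a b t : ℕ}
    (h : p * a + b = 1 + t * (N - 1)) :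
    ∃ τ : fullShiftGroup N, HasRotationForm p τ (Fin a) (Fin b) := by
  obtain ⟨u, hu⟩ := exists_isCode_univ t (J := (ZMod p × Fin a) ⊕ Fin b) (by simpa [ZMod.card])
  obtain ⟨τ, hτ⟩ := hu.exists_mem_fullShiftGroup (hu.reindex (rotation p _ _))
  exact ⟨τ, u, hu, hτ⟩

lemma exists_fixedKey_eq [Nontrivial (Fin N)] [hp : Fact p.Prime] (h : p ≡ 1 [MOD (N - 1)])
    (k : Option (ZMod (N - 1))) : ∃ (τ : fullShiftGroup N) (a b : ℕ),
      HasRotationForm p τ (Fin (a + 1)) (Fin b) ∧ fixedKey (N - 1) b = k := by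
  have hpos : 0 < N - 1 := Nat.sub_pos_of_lt one_lt_card_letters
  have : NeZero (N - 1) := ⟨hpos.ne'⟩
  obtain ⟨c, hc⟩ := (Nat.modEq_iff_dvd' hp.out.one_lt.le).1 h.symm
  have hpc : p = 1 + c * (N - 1) := by
    have := hp.out.one_lt
    rw [mul_comm c]
    omega
  cases k with
  | none =>
    obtain ⟨τ, hτ⟩ := exists_hasRotationForm_of_card (N := N) (p := p) (a := 0 + 1) (b := 0)
      (t := c) (by simpa using hpc)
    exact ⟨τ, 0, 0, hτ, rfl⟩
  | some r =>
    -- with `b` positive of residue `r`, the number of cycles has to have residue `1 - r`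
    obtain ⟨b, hb, hbr⟩ : ∃ b : ℕ, 0 < b ∧ (b : ZMod (N - 1)) = r :=
      ⟨r.val + (N - 1), by omega, by simp⟩
    obtain ⟨a, har⟩ : ∃ a : ℕ, ((a + 1 : ℕ) : ZMod (N - 1)) = 1 - r :=
      ⟨(-r).val, by push_cast; rw [ZMod.natCast_zmod_val]; ring⟩
    have h1 : 1 ≡ p * (a + 1) + b [MOD (N - 1)] := by
      rw [← ZMod.natCast_eq_natCast_iff] at h ⊢
      rw [Nat.cast_add, Nat.cast_mul, h, har, hbr]
      simp
    obtain ⟨t, ht⟩ := (Nat.modEq_iff_dvd' (hb.trans_le (Nat.le_add_left _ _))).1 h1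
    obtain ⟨τ, hτ⟩ := exists_hasRotationForm_of_card (N := N) (p := p) (a := a + 1) (b := b)
      (t := t) (by rw [mul_comm t, ← ht]; omega)
    exact ⟨τ, a, b, hτ, by simp [fixedKey, hb.ne', hbr]⟩

/-- For a prime `p ≡ 1 [MOD N - 1]`, the full group of the full `N`-shift has exactly `N` conjugacy
classes of elements of order `p`. -/
theorem card_conjClasses_orderOf_eq [Nontrivial (Fin N)] [Fact p.Prime]
    (hp : p ≡ 1 [MOD (N - 1)]) :
    Nat.card {c : ConjClasses (fullShiftGroup N) // ∃ τ, orderOf τ = p ∧ ConjClasses.mk τ = c} =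
      N := by
  have hN := one_lt_card_letters (N := N)
  have : NeZero (N - 1) := ⟨by omega⟩
  choose τ a b hτ hk using exists_fixedKey_eq (N := N) hp
  have hbij : Function.Bijective fun k => (⟨ConjClasses.mk (τ k), τ k, (hτ k).orderOf_eq, rfl⟩ :
      {c : ConjClasses (fullShiftGroup N) // ∃ τ, orderOf τ = p ∧ ConjClasses.mk τ = c}) := by
    refine ⟨fun k l hkl => ?_, ?_⟩
    · have := ConjClasses.mk_eq_mk_iff_isConj.1 (congrArg Subtype.val hkl)
      rw [(hτ k).isConj_iff_fixedKey_eq hp (hτ l), hk, hk] at this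
      exact this
    · rintro ⟨_, ρ, hρ, rfl⟩
      obtain ⟨a', b', h⟩ := exists_hasRotationForm hρ
      refine ⟨fixedKey (N - 1) b', Subtype.ext (ConjClasses.mk_eq_mk_iff_isConj.2 ?_)⟩
      rw [(hτ _).isConj_iff_fixedKey_eq hp h, hk]
  rw [← Nat.card_eq_of_bijective _ hbij, Nat.card_eq_fintype_card, Fintype.card_option, ZMod.card]
  omega

/-- Isomorphic groups have equally many conjugacy classes of elements of a given order. -/
lemma card_conjClasses_orderOf_congr {G H : Type*} [Group G] [Group H] (φ : G ≃* H) (n : ℕ) :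
    Nat.card {c : ConjClasses G // ∃ g, orderOf g = n ∧ ConjClasses.mk g = c} =
      Nat.card {c : ConjClasses H // ∃ g, orderOf g = n ∧ ConjClasses.mk g = c} := by
  refine Nat.card_eq_of_bijective (fun c => ⟨ConjClasses.map φ.toMonoidHom c.1, ?_⟩) ⟨?_, ?_⟩
  · obtain ⟨_, g, hg, rfl⟩ := c
    exact ⟨φ g, (φ.orderOf_eq g).trans hg, rfl⟩
  · rintro ⟨_, g, hg, rfl⟩ ⟨_, h, hh, rfl⟩ hgh
    have h1 : IsConj (φ g) (φ h) :=
      ConjClasses.mk_eq_mk_iff_isConj.1 (congrArg Subtype.val hgh)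
    refine Subtype.ext (ConjClasses.mk_eq_mk_iff_isConj.2 ?_)
    simpa using φ.symm.toMonoidHom.map_isConj h1
  · rintro ⟨_, h, hh, rfl⟩
    refine ⟨⟨_, φ.symm h, (φ.symm.orderOf_eq h).trans hh, rfl⟩, Subtype.ext ?_⟩
    exact congrArg ConjClasses.mk (φ.apply_symm_apply h)

end FullShift

theorem corollary1p5 (N M : ℕ) (hN : 1 < N) (hM : 1 < M) :
    Nonempty (fullShiftGroup N ≃* fullShiftGroup M) ↔ N = M := by
  refine ⟨fun ⟨φ⟩ => ?_, fun h => h ▸ ⟨MulEquiv.refl _⟩⟩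
  have : Nontrivial (Fin N) := Fin.nontrivial_iff_two_le.2 hN
  have : Nontrivial (Fin M) := Fin.nontrivial_iff_two_le.2 hM
  obtain ⟨p, hp, -, h⟩ := Nat.exists_prime_gt_modEq_one (k := (N - 1) * (M - 1)) 0
    (Nat.mul_ne_zero (by omega) (by omega))
  have : Fact p.Prime := ⟨hp⟩
  rw [← FullShift.card_conjClasses_orderOf_eq (N := N) (h.of_mul_right _),
    ← FullShift.card_conjClasses_orderOf_eq (N := M) (h.of_mul_left _),
    FullShift.card_conjClasses_orderOf_congr φ p]
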